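/- For positive integers $\alpha_1,\dots,\alpha_r$ with $\alpha_r\ge 2$, let $$\zeta^\star(\alpha_1,\dots,\alpha_r)=\sum_{1\le k_1\le k_2\le\cdots\le k_r}k_1^{-\alpha_1}k_2^{-\alpha_2}\cdots k_r^{-\alpha_r}$$ (a convergent series of positive terms), and let $\{a\}^m$ denote $m$ repetitions of $a$. Let $\zeta$ be the Riemann zeta function. Then for every integer $n\ge 0$, with the sums over all pairs of nonnegative integers $(p,q)$ with $p+q=2n+2$, all the series involved converge, and $$\sum_{p+q=2n+2}\zeta^\star(\{1\}^p,q+2)=(2n+3)\,\zeta^\star(\{2\}^{n+2})$$ and $$\sum_{p+q=2n+2}\zeta^\star(\{1\}^p,q+2)=2(2n+3)\left(1-\frac{1}{2^{2n+3}}\right)\zeta(2n+4).$$ -/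

import Mathlib

/-- The index set `{(k₁, …, k_r) : 1 ≤ k₁ ≤ k₂ ≤ ⋯ ≤ k_r}` of a multiple zeta-star series of
depth `r`; here `k i` is `k_{i+1}`. -/
def starIndices (r : ℕ) : Set (Fin r → ℕ) :=
  {k | Monotone k ∧ ∀ i, 1 ≤ k i}

/-- The general term `k₁^{-α₁} ⋯ k_r^{-α_r}` of the series. -/
noncomputable def starTerm {r : ℕ} (α : Fin r → ℕ) (k : starIndices r) : ℝ :=
  ∏ i, (((k : Fin r → ℕ) i : ℝ) ^ α i)⁻¹

/-- The multiple zeta-star value `ζ⋆(α₁, …, α_r)`, with the last index the largest one, so that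
the series converges when all `αᵢ ≥ 1` and `α_r ≥ 2`. -/
noncomputable def zetaStar {r : ℕ} (α : Fin r → ℕ) : ℝ :=
  ∑' k : starIndices r, starTerm α k

/-- The exponent sequence `({1}^p, a)`. -/
def onesThen (p a : ℕ) : Fin (p + 1) → ℕ :=
  Fin.snoc (α := fun _ => ℕ) (fun _ : Fin p => 1) a

/-- The exponent sequence `{2}^m`. -/
def twos (m : ℕ) : Fin m → ℕ := fun _ => 2

open Finset Filter Topology

open scoped PowerSeries Nat

/-! Both sides reduce to the alternating zeta value `altZeta` of weight `2n + 4`.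

Sum formula. The truncated sums for `{1}^p` have generating function `∏ (1 - X/j)⁻¹` over `j ≤ k +
1`, which is `(k + 1) * betaSeries 0 k`; formally `betaSeries M k` is the Beta value `B(M + 1 - X, k
+ 1)`. Summing over `p + q = N` therefore gives a coefficient of `F_0`, where `F_M = ∑ k, betaSeries
M k / (M + k + 1 - X)` (`sum_starSum_onesThen`). A telescoping identity, `betaPartialSum_add_succ`,
yields `F_M + F_{M+1} = 2 / (M + 1 - X)²` in the limit; iterating, `F_0 = 2 ∑ (-1)^M / (M + 1 -
X)²`, whose coefficients are `2 (N + 1) altZeta (N + 2)`.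

Twos. The generating function `∏ (1 - x/j²)⁻¹` over `j ≤ K` is split into partial fractions with
explicit binomial coefficients (`starSum_twos`). These tend boundedly to `2 (-1)^j`, so the limit is
`2 altZeta (2m)`. Comparing gives the first identity with `N = 2n + 2`; `ofReal_altZeta` gives the
second. -/

/-! ### Truncated star sums and their limits -/

/-- The monotone tuples with entries in `{1, …, K}`. -/
noncomputable def boundedStarIndices (r K : ℕ) : Finset (Fin r → ℕ) :=
  open Classical in (Fintype.piFinset fun _ => Icc 1 K).filter Monotone

lemma mem_boundedStarIndices {r K : ℕ} {k : Fin r → ℕ} :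
    k ∈ boundedStarIndices r K ↔ Monotone k ∧ ∀ i, 1 ≤ k i ∧ k i ≤ K := by
  classical
  simp [boundedStarIndices, and_comm]

/-- The multiple zeta-star sum truncated to indices at most `K`. -/
noncomputable def starSum {r : ℕ} (α : Fin r → ℕ) (K : ℕ) : ℝ :=
  ∑ k ∈ boundedStarIndices r K, ∏ i, ((k i : ℝ) ^ α i)⁻¹

lemma starSum_depth_zero (α : Fin 0 → ℕ) (K : ℕ) : starSum α K = 1 := by
  have : boundedStarIndices 0 K = {Fin.elim0} := by
    ext k
    simp only [mem_boundedStarIndices, mem_singleton]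
    exact ⟨fun _ => Subsingleton.elim _ _, fun _ => ⟨fun i => i.elim0, fun i => i.elim0⟩⟩
  simp [starSum, this]

lemma starSum_zero {r : ℕ} (α : Fin (r + 1) → ℕ) : starSum α 0 = 0 := by
  have : boundedStarIndices (r + 1) 0 = ∅ := by
    ext k
    simp only [mem_boundedStarIndices, notMem_empty, iff_false]
    rintro ⟨-, h⟩
    have := h 0
    omega
  simp [starSum, this]

lemma monotone_snoc {r : ℕ} {k : Fin r → ℕ} {a : ℕ} (hk : Monotone k) (ha : ∀ i, k i ≤ a) :
    Monotone (Fin.snoc (α := fun _ => ℕ) k a) := by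
  intro i j hij
  induction j using Fin.lastCases with
  | last =>
    induction i using Fin.lastCases with
    | last => simp
    | cast i => simpa using ha i
  | cast j =>
    induction i using Fin.lastCases with
    | last => exact absurd hij (not_le.mpr (Fin.castSucc_lt_last j))
    | cast i => simpa using hk (Fin.castSucc_le_castSucc_iff.mp hij)

lemma boundedStarIndices_succ (r K : ℕ) :
    boundedStarIndices (r + 1) (K + 1) = boundedStarIndices (r + 1) K ∪
      (boundedStarIndices r (K + 1)).image fun k => Fin.snoc (α := fun _ => ℕ) k (K + 1) := by
  ext k
  simp only [mem_union, mem_image, mem_boundedStarIndices]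
  constructor
  · rintro ⟨hm, hk⟩
    by_cases h : k (Fin.last r) = K + 1
    · refine Or.inr ⟨Fin.init k, ⟨fun i j hij => hm (Fin.castSucc_le_castSucc_iff.mpr hij),
        fun i => hk _⟩, ?_⟩
      rw [← h, Fin.snoc_init_self]
    · refine Or.inl ⟨hm, fun i => ⟨(hk i).1, ?_⟩⟩
      have h1 := hm (Fin.le_last i)
      have h2 := (hk (Fin.last r)).2
      omega
  · rintro (⟨hm, hk⟩ | ⟨k, ⟨hm, hk⟩, rfl⟩)
    · exact ⟨hm, fun i => ⟨(hk i).1, (hk i).2.trans K.le_succ⟩⟩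
    · refine ⟨monotone_snoc hm fun i => (hk i).2, fun i => ?_⟩
      induction i using Fin.lastCases with
      | last => simp
      | cast i => simpa using hk i

/-- Splits by whether the largest entry equals `K + 1`. All later evaluations of truncated sums are
inductions on this recursion. -/
lemma starSum_succ {r : ℕ} (α : Fin (r + 1) → ℕ) (K : ℕ) :
    starSum α (K + 1) = starSum α K +
      (((K : ℝ) + 1) ^ α (Fin.last r))⁻¹ * starSum (Fin.init α) (K + 1) := by
  have hd : Disjoint (boundedStarIndices (r + 1) K)
      ((boundedStarIndices r (K + 1)).image fun k => Fin.snoc (α := fun _ => ℕ) k (K + 1)) := by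
    rw [Finset.disjoint_left]
    intro k hk hk'
    obtain ⟨l, -, rfl⟩ := mem_image.mp hk'
    have := ((mem_boundedStarIndices.mp hk).2 (Fin.last r)).2
    simp at this
  rw [starSum, boundedStarIndices_succ, sum_union hd, sum_image, starSum, starSum, mul_sum]
  · congr 1
    refine sum_congr rfl fun k _ => ?_
    rw [Fin.prod_univ_castSucc, mul_comm]
    simp [Fin.init]
  · intro k _ l _ h
    simpa using congrArg (Fin.init (α := fun _ => ℕ)) h

lemma starSum_eq_sum_range {r : ℕ} (α : Fin (r + 1) → ℕ) (K : ℕ) :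
    starSum α K = ∑ k ∈ range K,
      (((k : ℝ) + 1) ^ α (Fin.last r))⁻¹ * starSum (Fin.init α) (k + 1) := by
  induction K with
  | zero => simp [starSum_zero]
  | succ K ih => rw [starSum_succ, sum_range_succ, ih]

lemma boundedStarIndices_mono (r : ℕ) : Monotone (boundedStarIndices r) := by
  intro K L h k
  simp only [mem_boundedStarIndices]
  exact fun ⟨hm, hk⟩ => ⟨hm, fun i => ⟨(hk i).1, (hk i).2.trans h⟩⟩

lemma starSum_nonneg {r : ℕ} (α : Fin r → ℕ) (K : ℕ) : 0 ≤ starSum α K :=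
  sum_nonneg fun _ _ => prod_nonneg fun _ _ => by positivity

lemma starTerm_nonneg {r : ℕ} (α : Fin r → ℕ) (k : starIndices r) : 0 ≤ starTerm α k :=
  prod_nonneg fun _ _ => by positivity

/-- `boundedStarIndices` as a finite set of elements of `starIndices`. -/
noncomputable def starIndicesBelow (r K : ℕ) : Finset (starIndices r) :=
  open Classical in (boundedStarIndices r K).subtype (· ∈ starIndices r)

lemma mem_starIndicesBelow {r K : ℕ} {k : starIndices r} :
    k ∈ starIndicesBelow r K ↔ ∀ i, (k : Fin r → ℕ) i ≤ K := by
  classical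
  rw [starIndicesBelow, mem_subtype, mem_boundedStarIndices]
  exact ⟨fun h i => (h.2 i).2, fun h => ⟨k.2.1, fun i => ⟨k.2.2 i, h i⟩⟩⟩

lemma sum_starIndicesBelow {r : ℕ} (α : Fin r → ℕ) (K : ℕ) :
    ∑ k ∈ starIndicesBelow r K, starTerm α k = starSum α K := by
  classical
  rw [starSum, starIndicesBelow]
  refine sum_subtype_of_mem (fun k : Fin r → ℕ => ∏ i, ((k i : ℝ) ^ α i)⁻¹) fun k hk => ?_
  obtain ⟨hm, hk⟩ := mem_boundedStarIndices.mp hk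
  exact ⟨hm, fun i => (hk i).1⟩

lemma exists_subset_starIndicesBelow {r : ℕ} (s : Finset (starIndices r)) :
    ∃ K, s ⊆ starIndicesBelow r K := by
  refine ⟨s.sup fun k => univ.sup (k : Fin r → ℕ), fun k hk => ?_⟩
  rw [mem_starIndicesBelow]
  intro i
  exact (le_sup (f := (k : Fin r → ℕ)) (mem_univ i)).trans
    (le_sup (f := fun k : starIndices r => univ.sup (k : Fin r → ℕ)) hk)

lemma summable_starTerm_of_le {r : ℕ} {α : Fin r → ℕ} {c : ℝ} (h : ∀ K, starSum α K ≤ c) :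
    Summable (starTerm α) := by
  refine summable_of_sum_le (c := c) (starTerm_nonneg α) fun s => ?_
  obtain ⟨K, hK⟩ := exists_subset_starIndicesBelow s
  calc ∑ k ∈ s, starTerm α k ≤ ∑ k ∈ starIndicesBelow r K, starTerm α k :=
        sum_le_sum_of_subset_of_nonneg hK fun k _ _ => starTerm_nonneg α k
    _ ≤ c := (sum_starIndicesBelow α K).trans_le (h K)

lemma tendsto_starSum {r : ℕ} {α : Fin r → ℕ} (h : Summable (starTerm α)) :
    Tendsto (starSum α) atTop (𝓝 (zetaStar α)) := by
  have hs : Tendsto (starIndicesBelow r) atTop atTop := by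
    refine tendsto_atTop_finset_of_monotone (fun K L hKL k => ?_) fun k => ?_
    · simp only [mem_starIndicesBelow]
      exact fun hk i => (hk i).trans hKL
    · obtain ⟨K, hK⟩ := exists_subset_starIndicesBelow {k}
      exact ⟨K, hK (mem_singleton_self k)⟩
  refine (h.hasSum.comp hs).congr fun K => ?_
  simp [sum_starIndicesBelow]

lemma starSum_mono {r : ℕ} (α : Fin r → ℕ) : Monotone (starSum α) := fun _ _ h =>
  sum_le_sum_of_subset_of_nonneg (boundedStarIndices_mono r h)
    fun _ _ _ => prod_nonneg fun _ _ => by positivity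

lemma summable_starTerm_of_tendsto {r : ℕ} {α : Fin r → ℕ} {c : ℝ}
    (h : Tendsto (starSum α) atTop (𝓝 c)) : Summable (starTerm α) :=
  summable_starTerm_of_le fun K => (starSum_mono α).ge_of_tendsto h K

lemma zetaStar_eq_of_tendsto {r : ℕ} {α : Fin r → ℕ} {c : ℝ}
    (h : Tendsto (starSum α) atTop (𝓝 c)) : zetaStar α = c :=
  tendsto_nhds_unique (tendsto_starSum (summable_starTerm_of_tendsto h)) h

/-! ### Beta series and their telescoping -/

/-- The power series of `1 / (a - X)`. -/
noncomputable def invSubX (a : ℝ) : ℝ⟦X⟧ := PowerSeries.mk fun n => (a ^ (n + 1))⁻¹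

lemma sub_X_mul_invSubX {a : ℝ} (ha : a ≠ 0) :
    (PowerSeries.C a - PowerSeries.X) * invSubX a = 1 := by
  ext n
  rw [sub_mul, map_sub, PowerSeries.coeff_C_mul]
  cases n with
  | zero => simp [invSubX, ha]
  | succ n =>
    rw [PowerSeries.coeff_succ_X_mul, PowerSeries.coeff_one]
    simp only [invSubX, PowerSeries.coeff_mk]
    rw [if_neg n.succ_ne_zero]
    field_simp
    ring

lemma coeff_invSubX_mul_self (a : ℝ) (N : ℕ) :
    (invSubX a * invSubX a).coeff N = (N + 1) * (a ^ (N + 2))⁻¹ := by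
  rw [PowerSeries.coeff_mul, sum_congr rfl (g := fun _ => (a ^ (N + 2))⁻¹)]
  · simp
  · intro p hp
    rw [HasAntidiagonal.mem_antidiagonal] at hp
    simp only [invSubX, PowerSeries.coeff_mk]
    rw [← mul_inv, ← pow_add]
    congr 2
    omega

lemma coeff_mul_nonneg {f g : ℝ⟦X⟧} (hf : ∀ n, 0 ≤ f.coeff n) (hg : ∀ n, 0 ≤ g.coeff n) (n : ℕ) :
    0 ≤ (f * g).coeff n := by
  rw [PowerSeries.coeff_mul]
  exact sum_nonneg fun p _ => mul_nonneg (hf _) (hg _)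

lemma coeff_invSubX_nonneg {a : ℝ} (ha : 0 ≤ a) (n : ℕ) : 0 ≤ (invSubX a).coeff n := by
  simp only [invSubX, PowerSeries.coeff_mk]
  positivity

/-- The power series of `k! / ((M + 1 - X) ⋯ (M + k + 1 - X))`. -/
noncomputable def betaSeries (M k : ℕ) : ℝ⟦X⟧ :=
  PowerSeries.C (k ! : ℝ) * ∏ j ∈ range (k + 1), invSubX (M + j + 1)

lemma coeff_betaSeries_nonneg (M k n : ℕ) : 0 ≤ (betaSeries M k).coeff n := by
  have h : ∀ m n, 0 ≤ (∏ j ∈ range m, invSubX ((M : ℝ) + j + 1)).coeff n := by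
    intro m
    induction m with
    | zero =>
      intro n
      rw [prod_range_zero, PowerSeries.coeff_one]
      split_ifs <;> norm_num
    | succ m ih =>
      rw [prod_range_succ]
      exact coeff_mul_nonneg ih (coeff_invSubX_nonneg (by positivity))
  rw [betaSeries, PowerSeries.coeff_C_mul]
  exact mul_nonneg (by positivity) (h _ _)

lemma betaSeries_zero_right (M : ℕ) : betaSeries M 0 = invSubX (M + 1) := by
  simp [betaSeries]

lemma betaSeries_succ_right (M k : ℕ) :
    betaSeries M (k + 1) = PowerSeries.C ((k : ℝ) + 1) * betaSeries M k * invSubX (M + k + 2) := by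
  rw [betaSeries, betaSeries, prod_range_succ, Nat.factorial_succ]
  push_cast
  rw [map_mul, show (M : ℝ) + (k + 1) + 1 = M + k + 2 by ring]
  ring

lemma sub_X_mul_betaSeries_succ (M k : ℕ) :
    (PowerSeries.C ((M : ℝ) + k + 2) - PowerSeries.X) * betaSeries M (k + 1) =
      PowerSeries.C ((k : ℝ) + 1) * betaSeries M k := by
  rw [betaSeries_succ_right]
  linear_combination (PowerSeries.C ((k : ℝ) + 1) * betaSeries M k) *
    sub_X_mul_invSubX (a := (M : ℝ) + k + 2) (by positivity)

/-- The two products share all factors except the first of one and the last of the other. -/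
lemma betaSeries_succ_left (M k : ℕ) :
    betaSeries (M + 1) k =
      betaSeries M k * invSubX (M + k + 2) * (PowerSeries.C ((M : ℝ) + 1) - PowerSeries.X) := by
  have h1 : (∏ j ∈ range (k + 1), invSubX (((M + 1 : ℕ) : ℝ) + j + 1)) * invSubX (M + 1) =
      (∏ j ∈ range (k + 1), invSubX ((M : ℝ) + j + 1)) * invSubX (M + k + 2) := by
    have h2 := prod_range_succ (fun j : ℕ => invSubX ((M : ℝ) + j + 1)) (k + 1)
    rw [prod_range_succ'] at h2
    convert h2 using 2
    · refine prod_congr rfl fun j _ => ?_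
      push_cast
      congr 1
      ring
    · simp
    · push_cast
      congr 1
      ring
  have h3 := sub_X_mul_invSubX (a := (M : ℝ) + 1) (by positivity)
  rw [betaSeries, betaSeries]
  linear_combination (PowerSeries.C (k ! : ℝ) * (PowerSeries.C ((M : ℝ) + 1) - PowerSeries.X)) * h1
    - (PowerSeries.C (k ! : ℝ) * ∏ j ∈ range (k + 1), invSubX (((M + 1 : ℕ) : ℝ) + j + 1)) * h3

lemma coeff_betaSeries_succ (M k n : ℕ) :
    ((M : ℝ) + k + 2) * (betaSeries M (k + 1)).coeff (n + 1) =
      (k + 1) * (betaSeries M k).coeff (n + 1) + (betaSeries M (k + 1)).coeff n := by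
  have h := congrArg (PowerSeries.coeff (n + 1)) (sub_X_mul_betaSeries_succ M k)
  rw [sub_mul, map_sub, PowerSeries.coeff_C_mul, PowerSeries.coeff_succ_X_mul,
    PowerSeries.coeff_C_mul] at h
  linarith

lemma coeff_zero_betaSeries_succ (M k : ℕ) :
    ((M : ℝ) + k + 2) * (betaSeries M (k + 1)).coeff 0 = (k + 1) * (betaSeries M k).coeff 0 := by
  have h := congrArg (PowerSeries.coeff 0) (sub_X_mul_betaSeries_succ M k)
  rw [sub_mul, map_sub, PowerSeries.coeff_C_mul, PowerSeries.coeff_zero_X_mul,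
    PowerSeries.coeff_C_mul] at h
  linarith

/-- The bounds on `(k + 1) * e k` telescope, so `e k` is dominated by `e 0 / k` plus a Cesàro mean
of `b`. -/
lemma tendsto_zero_of_weighted_increment_le {e b : ℕ → ℝ} (he : ∀ k, 0 ≤ e k)
    (hb : Tendsto b atTop (𝓝 0))
    (h : ∀ k : ℕ, ((k : ℝ) + 2) * e (k + 1) ≤ (k + 1) * e k + b k) :
    Tendsto e atTop (𝓝 0) := by
  have h1 : ∀ k : ℕ, ((k : ℝ) + 1) * e k ≤ e 0 + ∑ i ∈ range k, b i := by
    intro k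
    induction k with
    | zero => simp
    | succ k ih =>
      rw [sum_range_succ]
      push_cast
      have := h k
      linarith
  have h2 : Tendsto (fun k : ℕ => (k : ℝ)⁻¹ * e 0 + (k : ℝ)⁻¹ * ∑ i ∈ range k, b i)
      atTop (𝓝 0) := by
    simpa using (tendsto_inv_atTop_nhds_zero_nat (𝕜 := ℝ)).mul_const (e 0) |>.add hb.cesaro
  refine tendsto_of_tendsto_of_tendsto_of_le_of_le' tendsto_const_nhds h2
    (Eventually.of_forall he) ?_
  filter_upwards [eventually_gt_atTop 0] with k hk
  have hk' : (0 : ℝ) < k := by exact_mod_cast hk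
  rw [← mul_add, ← div_eq_inv_mul, le_div_iff₀ hk']
  nlinarith [h1 k, he k]

lemma tendsto_coeff_betaSeries (M n : ℕ) :
    Tendsto (fun k => (betaSeries M k).coeff n) atTop (𝓝 0) := by
  induction n with
  | zero =>
    refine tendsto_zero_of_weighted_increment_le (fun k => coeff_betaSeries_nonneg M k 0)
      (tendsto_const_nhds (x := 0)) fun k => ?_
    have h1 := coeff_zero_betaSeries_succ M k
    have h2 := mul_nonneg (Nat.cast_nonneg (α := ℝ) M) (coeff_betaSeries_nonneg M (k + 1) 0)
    linarith
  | succ n ih =>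
    refine tendsto_zero_of_weighted_increment_le (fun k => coeff_betaSeries_nonneg M k (n + 1))
      ((tendsto_add_atTop_iff_nat 1).mpr ih) fun k => ?_
    have h1 := coeff_betaSeries_succ M k n
    have h2 := mul_nonneg (Nat.cast_nonneg (α := ℝ) M) (coeff_betaSeries_nonneg M (k + 1) (n + 1))
    linarith

/-- The first `K` terms of `∑ k, k! / ((M + k + 1 - X) (M + 1 - X) ⋯ (M + k + 1 - X))`. -/
noncomputable def betaPartialSum (M K : ℕ) : ℝ⟦X⟧ :=
  ∑ k ∈ range K, invSubX (M + k + 1) * betaSeries M k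

/-- The finite form of `F_M + F_{M+1} = 2 / (M + 1 - X)²`; the subtracted product is the boundary
term, shown to vanish in `tendsto_coeff_boundary`. -/
lemma betaPartialSum_add_succ (M K : ℕ) :
    betaPartialSum M K + betaPartialSum (M + 1) K =
      2 * (invSubX (M + 1) * invSubX (M + 1)) -
        (invSubX (M + 1) + invSubX (M + K + 1)) * betaSeries M K := by
  induction K with
  | zero =>
    simp [betaPartialSum, betaSeries_zero_right]
    ring
  | succ K ih =>
    have hz := sub_X_mul_invSubX (a := (M : ℝ) + 1) (by positivity)
    have hy := sub_X_mul_invSubX (a := (M : ℝ) + K + 2) (by positivity)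
    -- Expresses everything through the constants `w` and `c`, so that `hy` and `hz` are the only
    -- relations needed.
    have hw : PowerSeries.C ((M : ℝ) + K + 2) =
        PowerSeries.C ((M : ℝ) + 1) + PowerSeries.C ((K : ℝ) + 1) := by
      rw [← map_add]
      congr 1
      ring
    rw [hw] at hy
    rw [betaPartialSum, betaPartialSum, sum_range_succ, sum_range_succ, ← betaPartialSum,
      ← betaPartialSum, betaSeries_succ_left, betaSeries_succ_right]
    push_cast
    rw [show (M : ℝ) + 1 + K + 1 = M + K + 2 by ring, show (M : ℝ) + (K + 1) + 1 = M + K + 2 by ring]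
    set z := invSubX ((M : ℝ) + 1)
    set y := invSubX ((M : ℝ) + K + 2)
    set P := betaSeries M K
    set w := PowerSeries.C ((M : ℝ) + 1)
    set c := PowerSeries.C ((K : ℝ) + 1)
    linear_combination ih + P * (y + z) * hy - P * y * hz

lemma betaPartialSum_coeff_nonneg (M K n : ℕ) : 0 ≤ (betaPartialSum M K).coeff n := by
  rw [betaPartialSum, map_sum]
  exact sum_nonneg fun k _ =>
    coeff_mul_nonneg (coeff_invSubX_nonneg (by positivity)) (coeff_betaSeries_nonneg M k) n

lemma betaPartialSum_coeff_mono (M n : ℕ) : Monotone fun K => (betaPartialSum M K).coeff n := by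
  refine monotone_nat_of_le_succ fun K => ?_
  simp only [betaPartialSum]
  rw [sum_range_succ, map_add, le_add_iff_nonneg_right]
  exact coeff_mul_nonneg (coeff_invSubX_nonneg (by positivity)) (coeff_betaSeries_nonneg M K) n

lemma betaPartialSum_coeff_add_succ (M K N : ℕ) :
    (betaPartialSum M K).coeff N + (betaPartialSum (M + 1) K).coeff N =
      2 * ((N + 1) * (((M : ℝ) + 1) ^ (N + 2))⁻¹) -
        ((invSubX (M + 1) + invSubX (M + K + 1)) * betaSeries M K).coeff N := by
  rw [← map_add, betaPartialSum_add_succ, map_sub, ← coeff_invSubX_mul_self, two_mul, two_mul,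
    map_add]

lemma tendsto_coeff_boundary (M N : ℕ) :
    Tendsto (fun K : ℕ => ((invSubX (M + 1) + invSubX (M + K + 1)) * betaSeries M K).coeff N)
      atTop (𝓝 0) := by
  have h : Tendsto (fun K : ℕ => ∑ p ∈ HasAntidiagonal.antidiagonal N,
      (2 * (invSubX ((M : ℝ) + 1)).coeff p.1) * (betaSeries M K).coeff p.2) atTop (𝓝 0) := by
    have := tendsto_finsetSum (HasAntidiagonal.antidiagonal N) fun p _ =>
      (tendsto_coeff_betaSeries M p.2).const_mul (2 * (invSubX ((M : ℝ) + 1)).coeff p.1)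
    simpa using this
  refine squeeze_zero (fun K => ?_) (fun K => ?_) h
  · refine coeff_mul_nonneg (fun n => ?_) (coeff_betaSeries_nonneg M K) N
    rw [map_add]
    exact add_nonneg (coeff_invSubX_nonneg (by positivity) n)
      (coeff_invSubX_nonneg (by positivity) n)
  · rw [PowerSeries.coeff_mul]
    refine sum_le_sum fun p _ =>
      mul_le_mul_of_nonneg_right ?_ (coeff_betaSeries_nonneg M K p.2)
    rw [map_add, two_mul, add_le_add_iff_left]
    simp only [invSubX, PowerSeries.coeff_mk]
    gcongr
    linarith [Nat.cast_nonneg (α := ℝ) K]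

lemma betaPartialSum_coeff_le (M K N : ℕ) :
    (betaPartialSum M K).coeff N ≤ 2 * ((N + 1) * (((M : ℝ) + 1) ^ (N + 2))⁻¹) := by
  have h1 := betaPartialSum_coeff_add_succ M K N
  have h2 := betaPartialSum_coeff_nonneg (M + 1) K N
  have h3 : 0 ≤ ((invSubX ((M : ℝ) + 1) + invSubX (M + K + 1)) * betaSeries M K).coeff N := by
    refine coeff_mul_nonneg (fun n => ?_) (coeff_betaSeries_nonneg M K) N
    rw [map_add]
    exact add_nonneg (coeff_invSubX_nonneg (by positivity) n)
      (coeff_invSubX_nonneg (by positivity) n)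
  linarith

lemma exists_tendsto_betaPartialSum_coeff (M N : ℕ) :
    ∃ a, Tendsto (fun K => (betaPartialSum M K).coeff N) atTop (𝓝 a) :=
  ⟨_, tendsto_atTop_ciSup (betaPartialSum_coeff_mono M N)
    ⟨_, Set.forall_mem_range.mpr fun K => betaPartialSum_coeff_le M K N⟩⟩

/-- If the alternating sum of the `(m + 1)^{-(N + 2)}` is `s`, then `2 (N + 1) s` is the
coefficient of the full series. -/
lemma tendsto_betaPartialSum_coeff {N : ℕ} {s : ℝ}
    (hs : Tendsto (fun M => ∑ m ∈ range M, (-1 : ℝ) ^ m * (((m : ℝ) + 1) ^ (N + 2))⁻¹)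
      atTop (𝓝 s)) :
    Tendsto (fun K => (betaPartialSum 0 K).coeff N) atTop (𝓝 (2 * (N + 1) * s)) := by
  choose a ha using fun M => exists_tendsto_betaPartialSum_coeff M N
  have hrec : ∀ M : ℕ, a M + a (M + 1) = 2 * ((N + 1) * (((M : ℝ) + 1) ^ (N + 2))⁻¹) := by
    intro M
    refine tendsto_nhds_unique ((ha M).add (ha (M + 1))) ?_
    simp only [betaPartialSum_coeff_add_succ]
    simpa using (tendsto_coeff_boundary M N).const_sub
      (2 * (((N : ℝ) + 1) * (((M : ℝ) + 1) ^ (N + 2))⁻¹))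
  have hsum : ∀ M : ℕ, 2 * ((N : ℝ) + 1) *
      ∑ m ∈ range M, (-1 : ℝ) ^ m * (((m : ℝ) + 1) ^ (N + 2))⁻¹ = a 0 - (-1) ^ M * a M := by
    intro M
    induction M with
    | zero => simp
    | succ M ih =>
      rw [sum_range_succ, mul_add, ih, pow_succ]
      linear_combination (-(-1 : ℝ) ^ M) * hrec M
  -- The remainder of the iterated recursion vanishes: `a M` is at most a constant over `M + 1`.
  have ha0 : Tendsto (fun M => (-1 : ℝ) ^ M * a M) atTop (𝓝 0) := by
    refine squeeze_zero_norm (a := fun M : ℕ => 2 * ((N : ℝ) + 1) * (((M : ℝ) + 1)⁻¹))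
      (fun M => ?_) ?_
    · rw [norm_mul, norm_pow, norm_neg, norm_one, one_pow, one_mul, Real.norm_of_nonneg
        (ge_of_tendsto' (ha M) fun K => betaPartialSum_coeff_nonneg M K N)]
      refine le_of_tendsto' (ha M) fun K => (betaPartialSum_coeff_le M K N).trans ?_
      rw [← mul_assoc]
      gcongr
      exact le_self_pow₀ (by linarith [Nat.cast_nonneg (α := ℝ) M]) (by omega)
    · simpa using (tendsto_one_div_add_atTop_nhds_zero_nat (𝕜 := ℝ)).const_mul
        (2 * ((N : ℝ) + 1))
  have hlim : Tendsto (fun M => a 0 - (-1 : ℝ) ^ M * a M) atTop (𝓝 (a 0)) := by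
    simpa using ha0.const_sub (a 0)
  have := tendsto_nhds_unique ((hs.const_mul (2 * ((N : ℝ) + 1))).congr hsum) hlim
  rw [this]
  exact ha 0

/-! ### Partial fractions and the value at `{2}^m` -/

/-- The coefficients of the partial fraction expansion of `∏ j ∈ {1, …, K}, (1 - x / j²)⁻¹`, the
one at index `j` belonging to `(1 - x / (j + 1)²)⁻¹`. -/
noncomputable def sineCoeff (K j : ℕ) : ℝ :=
  2 * (-1) ^ j * ((2 * K).choose (K + j + 1) / (2 * K).choose K)

lemma sineCoeff_eq_zero {K j : ℕ} (h : K ≤ j) : sineCoeff K j = 0 := by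
  rw [sineCoeff, Nat.choose_eq_zero_of_lt (by omega)]
  simp

lemma choose_two_mul_succ {K i : ℕ} (h : i ≤ K + 1) :
    ((2 * (K + 1)).choose (K + 1 + i) : ℝ) * ((K + 1 - i) * (K + 1 + i)) =
      (2 * K).choose (K + i) * ((2 * K + 2) * (2 * K + 1)) := by
  have h1 := congrArg (Nat.cast (R := ℝ)) (Nat.choose_mul_succ_eq (2 * K) (K + i))
  have h2 := congrArg (Nat.cast (R := ℝ)) (Nat.add_one_mul_choose_eq (2 * K + 1) (K + i))
  rw [show 2 * K + 1 - (K + i) = K + 1 - i by omega, Nat.cast_mul, Nat.cast_mul,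
    Nat.cast_sub h] at h1
  rw [show 2 * K + 1 + 1 = 2 * (K + 1) by ring, show K + i + 1 = K + 1 + i by ring] at h2
  push_cast at h1 h2
  linear_combination (-(2 * (K : ℝ) + 2)) * h1 - ((K : ℝ) + 1 - i) * h2

/-- A new factor `(1 - x/(K + 1)²)⁻¹` multiplies the coefficient at the pole `x = (j + 1)²` by its
value there. At `j = K` both sides vanish. -/
lemma sineCoeff_succ {K j : ℕ} (h : j ≤ K) :
    sineCoeff (K + 1) j * (1 - ((j : ℝ) + 1) ^ 2 / (K + 1) ^ 2) = sineCoeff K j := by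
  have h1 := choose_two_mul_succ (K := K) (i := j + 1) (by omega)
  have h2 := choose_two_mul_succ (K := K) (i := 0) (by omega)
  have h3 : ((2 * K).choose K : ℝ) ≠ 0 := by
    exact_mod_cast (Nat.choose_pos (by omega)).ne'
  have h4 : ((2 * (K + 1)).choose (K + 1) : ℝ) ≠ 0 := by
    exact_mod_cast (Nat.choose_pos (by omega)).ne'
  have h5 : (K : ℝ) + 1 ≠ 0 := by positivity
  have h6 : (2 * (K : ℝ) + 2) * (2 * K + 1) ≠ 0 := by positivity
  rw [← add_assoc, ← add_assoc] at h1
  simp only [add_zero] at h2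
  push_cast at h1 h2
  rw [sineCoeff, sineCoeff]
  set a := ((2 * (K + 1)).choose (K + 1 + j + 1) : ℝ)
  set b := ((2 * (K + 1)).choose (K + 1) : ℝ)
  set c := ((2 * K).choose (K + j + 1) : ℝ)
  set d := ((2 * K).choose K : ℝ)
  have h7 : a * (((K : ℝ) + 1) ^ 2 - (j + 1) ^ 2) * d = b * (K + 1) ^ 2 * c := by
    apply mul_right_cancel₀ h6
    linear_combination (d * ((2 * (K : ℝ) + 2) * (2 * K + 1))) * h1 -
      (c * ((2 * (K : ℝ) + 2) * (2 * K + 1))) * h2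
  field_simp
  linear_combination h7

/-- Pascal's rule makes the alternating sum telescope. -/
lemma sum_range_neg_one_pow_mul_choose (L J : ℕ) :
    ∑ j ∈ range J, (-1 : ℝ) ^ j * (2 * (L + 1)).choose (L + 1 + j + 1) =
      (2 * L + 1).choose (L + 1) - (-1) ^ J * (2 * L + 1).choose (L + 1 + J) := by
  induction J with
  | zero => simp
  | succ J ih =>
    have h : (2 * (L + 1)).choose (L + 1 + J + 1) =
        (2 * L + 1).choose (L + 1 + J) + (2 * L + 1).choose (L + 1 + (J + 1)) :=
      Nat.choose_succ_succ (2 * L + 1) (L + 1 + J)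
    rw [sum_range_succ, ih, h, pow_succ]
    push_cast
    ring

/-- The partial fraction expansion at `x = 0`. -/
lemma sum_sineCoeff {K : ℕ} (h : 1 ≤ K) : ∑ j ∈ range K, sineCoeff K j = 1 := by
  obtain ⟨L, rfl⟩ := Nat.exists_eq_add_of_le' h
  have h1 := sum_range_neg_one_pow_mul_choose L (L + 1)
  rw [Nat.choose_eq_zero_of_lt (show 2 * L + 1 < L + 1 + (L + 1) by omega)] at h1
  have h2 : ((2 * (L + 1)).choose (L + 1) : ℝ) = 2 * (2 * L + 1).choose (L + 1) := by
    rw [show 2 * (L + 1) = 2 * L + 1 + 1 by ring, Nat.choose_succ_succ, Nat.choose_symm_half]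
    push_cast
    ring
  have h3 : ((2 * L + 1).choose (L + 1) : ℝ) ≠ 0 := by
    exact_mod_cast (Nat.choose_pos (by omega)).ne'
  have h4 : ∀ j, sineCoeff (L + 1) j = 2 / ((2 * (L + 1)).choose (L + 1) : ℝ) *
      ((-1 : ℝ) ^ j * (2 * (L + 1)).choose (L + 1 + j + 1)) := fun j => by
    rw [sineCoeff]
    ring
  simp only [h4]
  rw [← mul_sum, h1, h2]
  field_simp
  simp

lemma init_twos (m : ℕ) : Fin.init (twos (m + 1)) = twos m := rfl

lemma starSum_twos (m : ℕ) {K : ℕ} (hK : 1 ≤ K) :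
    starSum (twos m) K = ∑ j ∈ range K, sineCoeff K j * ((((j : ℝ) + 1) ^ 2) ^ m)⁻¹ := by
  induction m generalizing K with
  | zero => simpa [starSum_depth_zero] using (sum_sineCoeff hK).symm
  | succ m ih =>
    -- At positive depth the formula also holds for `K = 0`, where both sides are zero, so the inner
    -- induction can start there.
    clear hK
    induction K with
    | zero => simp [starSum_zero]
    | succ K ihK =>
      have h1 : ∑ j ∈ range K, sineCoeff K j * ((((j : ℝ) + 1) ^ 2) ^ (m + 1))⁻¹ =
          ∑ j ∈ range (K + 1), sineCoeff K j * ((((j : ℝ) + 1) ^ 2) ^ (m + 1))⁻¹ := by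
        rw [sum_range_succ, sineCoeff_eq_zero le_rfl, zero_mul, add_zero]
      rw [starSum_succ, ihK, init_twos, ih (by omega), h1, mul_sum, ← sum_add_distrib]
      refine sum_congr rfl fun j hj => ?_
      rw [← sineCoeff_succ (Nat.lt_succ_iff.mp (mem_range.mp hj)), pow_succ (((j : ℝ) + 1) ^ 2) m]
      simp only [twos]
      have h2 : (j : ℝ) + 1 ≠ 0 := by positivity
      have h3 : (K : ℝ) + 1 ≠ 0 := by positivity
      field_simp
      ring

lemma tendsto_choose_ratio (j : ℕ) :
    Tendsto (fun K : ℕ => ((2 * K).choose (K + j) : ℝ) / (2 * K).choose K) atTop (𝓝 1) := by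
  induction j with
  | zero =>
    refine tendsto_const_nhds.congr fun K => ?_
    rw [add_zero, div_self]
    exact_mod_cast (Nat.choose_pos (by omega)).ne'
  | succ j ih =>
    have h1 : Tendsto (fun K : ℕ => 1 - (2 * (j : ℝ) + 1) / ((K : ℝ) + (j + 1))) atTop (𝓝 1) := by
      have := (tendsto_atTop_add_const_right atTop ((j : ℝ) + 1)
        (tendsto_natCast_atTop_atTop (R := ℝ))).const_div_atTop (2 * (j : ℝ) + 1)
      simpa using this.const_sub 1
    have h2 := ih.mul h1
    rw [one_mul] at h2
    refine h2.congr' ?_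
    filter_upwards [eventually_ge_atTop j] with K hK
    have h3 := congrArg (Nat.cast (R := ℝ)) (Nat.choose_succ_right_eq (2 * K) (K + j))
    rw [show 2 * K - (K + j) = K - j by omega, Nat.cast_mul, Nat.cast_mul, Nat.cast_sub hK] at h3
    push_cast at h3
    have h4 : ((2 * K).choose K : ℝ) ≠ 0 := by
      exact_mod_cast (Nat.choose_pos (by omega)).ne'
    have h5 : (K : ℝ) + (j + 1) ≠ 0 := by positivity
    rw [← add_assoc]
    field_simp
    linear_combination -h3

lemma tendsto_sineCoeff (j : ℕ) :
    Tendsto (fun K => sineCoeff K j) atTop (𝓝 (2 * (-1) ^ j)) := by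
  simpa [sineCoeff, add_assoc] using (tendsto_choose_ratio (j + 1)).const_mul (2 * (-1 : ℝ) ^ j)

lemma abs_sineCoeff_le (K j : ℕ) : |sineCoeff K j| ≤ 2 := by
  have h : ((2 * K).choose (K + j + 1) : ℝ) ≤ (2 * K).choose K := by
    exact_mod_cast Nat.choose_le_centralBinom (K + j + 1) K
  rw [sineCoeff, abs_mul, abs_mul, abs_pow, abs_neg, abs_one, one_pow, mul_one,
    abs_of_nonneg (by positivity : (0 : ℝ) ≤ 2), abs_of_nonneg (by positivity)]
  have := div_le_one_of_le₀ h (by positivity)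
  linarith

/-- The alternating zeta value `∑ (-1)^(j-1) j^{-s}`. -/
noncomputable def altZeta (s : ℕ) : ℝ := ∑' j : ℕ, (-1 : ℝ) ^ j * (((j : ℝ) + 1) ^ s)⁻¹

lemma summable_inv_succ_pow {s : ℕ} (hs : 1 < s) :
    Summable fun j : ℕ => (((j : ℝ) + 1) ^ s)⁻¹ := by
  have := (summable_nat_add_iff 1).mpr (Real.summable_nat_pow_inv.mpr hs)
  simpa using this

lemma hasSum_altZeta {s : ℕ} (hs : 1 < s) :
    HasSum (fun j : ℕ => (-1 : ℝ) ^ j * (((j : ℝ) + 1) ^ s)⁻¹) (altZeta s) := by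
  refine Summable.hasSum (Summable.of_norm ?_)
  refine (summable_inv_succ_pow hs).congr fun j => ?_
  rw [norm_mul, norm_pow, norm_neg, norm_one, one_pow, one_mul, Real.norm_of_nonneg (by positivity)]

lemma tendsto_starSum_twos {m : ℕ} (hm : 1 ≤ m) :
    Tendsto (starSum (twos m)) atTop (𝓝 (2 * altZeta (2 * m))) := by
  have h := tendsto_tsum_of_dominated_convergence (𝓕 := atTop)
    (f := fun K j => sineCoeff K j * ((((j : ℝ) + 1) ^ 2) ^ m)⁻¹)
    (g := fun j => 2 * (-1) ^ j * ((((j : ℝ) + 1) ^ 2) ^ m)⁻¹)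
    (bound := fun j => 2 * (((j : ℝ) + 1) ^ (2 * m))⁻¹)
    ((summable_inv_succ_pow (by omega)).mul_left 2)
    (fun j => (tendsto_sineCoeff j).mul_const _)
    (Eventually.of_forall fun K j => by
      rw [norm_mul, Real.norm_eq_abs, ← pow_mul, Real.norm_of_nonneg (by positivity)]
      exact mul_le_mul_of_nonneg_right (abs_sineCoeff_le K j) (by positivity))
  have h1 : ∑' j : ℕ, 2 * (-1 : ℝ) ^ j * ((((j : ℝ) + 1) ^ 2) ^ m)⁻¹ = 2 * altZeta (2 * m) := by
    rw [altZeta, ← tsum_mul_left]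
    exact tsum_congr fun j => by rw [← pow_mul, mul_assoc]
  rw [h1] at h
  refine h.congr' ?_
  filter_upwards [eventually_ge_atTop 1] with K hK
  rw [starSum_twos m hK]
  refine tsum_eq_sum fun j hj => ?_
  rw [sineCoeff_eq_zero (by simpa using hj), zero_mul]

/-! ### The sum over `({1}^p, q + 2)` -/

lemma starSum_ones (p k : ℕ) :
    starSum (fun _ : Fin p => 1) (k + 1) = (k + 1) * (betaSeries 0 k).coeff p := by
  induction p generalizing k with
  | zero =>
    rw [starSum_depth_zero]
    induction k with
    | zero => simp [betaSeries_zero_right, invSubX]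
    | succ k ih =>
      have := coeff_zero_betaSeries_succ 0 k
      push_cast at this ⊢
      linarith
  | succ p ih =>
    have hs : ∀ K, starSum (fun _ : Fin (p + 1) => 1) (K + 1) =
        starSum (fun _ : Fin (p + 1) => 1) K +
          ((K : ℝ) + 1)⁻¹ * starSum (fun _ : Fin p => 1) (K + 1) := fun K => by
      rw [starSum_succ, pow_one]
      rfl
    induction k with
    | zero =>
      rw [hs, ih, starSum_zero]
      simp [betaSeries_zero_right, invSubX]
    | succ k ihk =>
      have := coeff_betaSeries_succ 0 k p
      rw [hs, ihk, ih]
      push_cast at this ⊢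
      rw [inv_mul_cancel_left₀ (by positivity)]
      linarith

lemma starSum_onesThen (p a K : ℕ) :
    starSum (onesThen p a) K = ∑ k ∈ range K,
      (((k : ℝ) + 1) ^ a)⁻¹ * ((k + 1) * (betaSeries 0 k).coeff p) := by
  rw [starSum_eq_sum_range]
  refine sum_congr rfl fun k _ => ?_
  rw [onesThen, Fin.snoc_last, Fin.init_snoc, starSum_ones]

/-- One factor `k + 1` cancels, leaving `(k + 1)^{-(q + 1)}`, the `q`-th coefficient of `1 / (k + 1
- X)`; the antidiagonal sum is then a Cauchy product. -/
lemma sum_starSum_onesThen (N K : ℕ) :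
    ∑ pq ∈ HasAntidiagonal.antidiagonal N, starSum (onesThen pq.1 (pq.2 + 2)) K =
      (betaPartialSum 0 K).coeff N := by
  simp only [starSum_onesThen]
  rw [sum_comm, betaPartialSum, map_sum]
  refine sum_congr rfl fun k _ => ?_
  rw [mul_comm (invSubX _), PowerSeries.coeff_mul]
  refine sum_congr rfl fun pq _ => ?_
  simp only [invSubX, PowerSeries.coeff_mk, Nat.cast_zero, zero_add]
  have : (k : ℝ) + 1 ≠ 0 := by positivity
  field_simp
  ring

lemma summable_starTerm_onesThen (p q : ℕ) : Summable (starTerm (onesThen p (q + 2))) := by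
  refine summable_starTerm_of_le fun K => le_trans ?_ (betaPartialSum_coeff_le 0 K (p + q))
  rw [← sum_starSum_onesThen]
  exact single_le_sum (f := fun pq : ℕ × ℕ => starSum (onesThen pq.1 (pq.2 + 2)) K)
    (fun pq _ => starSum_nonneg _ K)
    (HasAntidiagonal.mem_antidiagonal.mpr (rfl : (p, q).1 + (p, q).2 = p + q))

/-- The sum formula for the zeta-star values `ζ⋆({1}^p, q + 2)` of fixed weight. -/
lemma sum_zetaStar_onesThen (N : ℕ) :
    ∑ pq ∈ HasAntidiagonal.antidiagonal N, zetaStar (onesThen pq.1 (pq.2 + 2)) =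
      2 * (N + 1) * altZeta (N + 2) := by
  have h1 := tendsto_finsetSum (HasAntidiagonal.antidiagonal N) fun pq _ =>
    tendsto_starSum (summable_starTerm_onesThen pq.1 pq.2)
  simp only [sum_starSum_onesThen] at h1
  exact tendsto_nhds_unique h1
    (tendsto_betaPartialSum_coeff (hasSum_altZeta (by omega)).tendsto_sum_nat)

/-! ### From the alternating series to the Riemann zeta function -/

lemma altZeta_eq {s : ℕ} (hs : 1 < s) :
    altZeta s = (1 - 2 / 2 ^ s) * ∑' n : ℕ, ((n : ℝ) ^ s)⁻¹ := by
  have hsum : Summable fun n : ℕ => ((n : ℝ) ^ s)⁻¹ := Real.summable_nat_pow_inv.mpr hs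
  set Z := ∑' n : ℕ, ((n : ℝ) ^ s)⁻¹
  have he : HasSum (fun n : ℕ => (((2 * n : ℕ) : ℝ) ^ s)⁻¹) ((2 ^ s)⁻¹ * Z) := by
    refine (hsum.hasSum.mul_left ((2 : ℝ) ^ s)⁻¹).congr_fun fun n => ?_
    push_cast
    rw [mul_pow, mul_inv]
  have ho : HasSum (fun n : ℕ => (((2 * n + 1 : ℕ) : ℝ) ^ s)⁻¹)
      (∑' n : ℕ, (((2 * n + 1 : ℕ) : ℝ) ^ s)⁻¹) :=
    (hsum.comp_injective (i := fun n : ℕ => 2 * n + 1) fun a b h => by simpa using h).hasSum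
  have hZ := hsum.hasSum.unique (he.even_add_odd ho)
  -- The index starts at `0`, where the term is `0⁻¹ = 0`; the minus sign becomes `(-1)^j` after the
  -- shift `n = j + 1`.
  have ha : HasSum (fun n : ℕ => -((-1 : ℝ) ^ n * ((n : ℝ) ^ s)⁻¹)) (-((2 ^ s)⁻¹ * Z) +
      ∑' n : ℕ, (((2 * n + 1 : ℕ) : ℝ) ^ s)⁻¹) := by
    refine HasSum.even_add_odd (he.neg.congr_fun fun n => ?_) (ho.congr_fun fun n => ?_)
    · simp [pow_mul]
    · simp [pow_succ, pow_mul]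
  have hb := (hasSum_nat_add_iff' 1).mpr ha
  have hc : altZeta s = -((2 ^ s)⁻¹ * Z) + ∑' n : ℕ, (((2 * n + 1 : ℕ) : ℝ) ^ s)⁻¹ := by
    refine (hasSum_altZeta hs).unique ?_
    have h0 : ∑ n ∈ range 1, -((-1 : ℝ) ^ n * ((n : ℝ) ^ s)⁻¹) = 0 := by
      simp [show s ≠ 0 by omega]
    rw [h0, sub_zero] at hb
    refine hb.congr_fun fun n => ?_
    push_cast
    ring
  rw [hc]
  linear_combination -hZ

lemma ofReal_altZeta {s : ℕ} (hs : 1 < s) :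
    (altZeta s : ℂ) = (1 - 2 / 2 ^ s) * riemannZeta s := by
  rw [altZeta_eq hs, zeta_nat_eq_tsum_of_gt_one hs]
  push_cast
  simp

theorem proposition4p4 (n : ℕ) :
    (∀ pq ∈ Finset.HasAntidiagonal.antidiagonal (2 * n + 2), Summable (starTerm (onesThen pq.1 (pq.2 + 2)))) ∧
    Summable (starTerm (twos (n + 2))) ∧
    (∑ pq ∈ Finset.HasAntidiagonal.antidiagonal (2 * n + 2), zetaStar (onesThen pq.1 (pq.2 + 2))
      = (2 * (n : ℝ) + 3) * zetaStar (twos (n + 2))) ∧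
    ((∑ pq ∈ Finset.HasAntidiagonal.antidiagonal (2 * n + 2), zetaStar (onesThen pq.1 (pq.2 + 2)) : ℝ) : ℂ)
      = 2 * (2 * (n : ℂ) + 3) * (1 - 1 / 2 ^ (2 * n + 3)) * riemannZeta (2 * (n : ℂ) + 4) := by
  have h2 := tendsto_starSum_twos (m := n + 2) (by omega)
  refine ⟨fun pq _ => summable_starTerm_onesThen pq.1 pq.2, summable_starTerm_of_tendsto h2, ?_, ?_⟩
  · rw [sum_zetaStar_onesThen, zetaStar_eq_of_tendsto h2, show 2 * (n + 2) = 2 * n + 2 + 2 by ring]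
    push_cast
    ring
  · rw [sum_zetaStar_onesThen]
    have h := ofReal_altZeta (s := 2 * n + 2 + 2) (by omega)
    rw [Complex.ofReal_mul, h, show (2 : ℂ) / 2 ^ (2 * n + 2 + 2) = 1 / 2 ^ (2 * n + 3) by
      rw [pow_succ]; field_simp]
    push_cast
    rw [show 2 * (n : ℂ) + 2 + 2 = 2 * n + 4 by ring]
    ring
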